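/- For a finite simple graph $G$ on at least two vertices, let $\lambda_1(G)\ge\lambda_2(G)$ denote the largest and second largest eigenvalues (counted with multiplicity) of its adjacency matrix. For integers $k_1,k_2\ge 0$ and $\ell\ge 1$, let $DC(k_1,k_2,\ell)$ be the tree on $k_1+k_2+\ell$ vertices obtained from a path on $\ell$ vertices by attaching $k_1$ leaves to its first vertex and $k_2$ leaves to its last vertex. Let $n\ge 5$ and $H=DC\left(\lfloor\frac{n-3}{2}\rfloor,\lceil\frac{n-3}{2}\rceil,3\right)$. Then $H$ is a tree on $n$ vertices, and every tree $T$ on $n$ vertices satisfies $$\lambda_1(T)+\lambda_2(T)\le \lambda_1(H)+\lambda_2(H),$$ with equality if and only if $T$ is isomorphic to $H$. -/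

import Mathlib

open Classical in
/-- The eigenvalues of a finite simple graph `G`, that is, of its real adjacency matrix, listed with
multiplicity in non-increasing order and indexed from `0`: `adjEigenvalue G 0` is the largest
eigenvalue `λ₁(G)`, `adjEigenvalue G 1` is the second largest `λ₂(G)`, and so on.
(The value is `0` by convention when the index is at least the order of `G`.) -/
noncomputable def adjEigenvalue {V : Type*} [Fintype V] (G : SimpleGraph V) (i : ℕ) : ℝ :=
  if h : i < Fintype.card V then (G.isHermitian_adjMatrix ℝ).eigenvalues₀ ⟨i, h⟩ else 0

/-- The spectral sum `λ₁(G) + λ₂(G)`. -/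
noncomputable def spectralSum {V : Type*} [Fintype V] (G : SimpleGraph V) : ℝ :=
  adjEigenvalue G 0 + adjEigenvalue G 1

/-- The double comet `DC(k₁, k₂, ℓ)` (for `ℓ ≥ 1`): a path on the `ℓ` vertices `Fin ℓ`, with
`k₁` leaves attached to its first vertex and `k₂` leaves attached to its last vertex. -/
def doubleComet (k₁ k₂ ℓ : ℕ) : SimpleGraph (Fin k₁ ⊕ Fin ℓ ⊕ Fin k₂) where
  Adj x y :=
    match x, y with
    | .inl _, .inr (.inl p) => p.val = 0
    | .inr (.inl p), .inl _ => p.val = 0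
    | .inr (.inl p), .inr (.inl q) => p.val + 1 = q.val ∨ q.val + 1 = p.val
    | .inr (.inl p), .inr (.inr _) => p.val + 1 = ℓ
    | .inr (.inr _), .inr (.inl p) => p.val + 1 = ℓ
    | _, _ => False
  symm := ⟨by
    rintro (a | a | a) (b | b | b) h <;> simp_all
    exact h.symm⟩
  loopless := ⟨by
    rintro (a | a | a) h <;> simp_all⟩

/-! Write `N = n - 1` for the number of edges of a tree. A tree is bipartite, so its spectrum is
symmetric (`adjEigenvalue_rev_of_isBipartite`) and the squares of its positive eigenvalues add up
to `N`; if only two of them are positive, then `(λ₁ + λ₂)² = N + 2 λ₁ λ₂`.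

A forest either has a vertex cover of size two or contains a matching of size three
(`SimpleGraph.IsAcyclic.exists_cover_or_matching`).

With a cover `{u, w}` the form of the adjacency matrix vanishes on a subspace of codimension two, so
`λ₃ ≤ 0`, and counting closed walks of lengths two and four gives `λ₁² λ₂²` in terms of the sum of
the squared degrees (`SimpleGraph.IsTree.spectralSum_sq_of_cover`). That sum depends only on the
degrees of `u` and `w` and on whether they are adjacent
(`SimpleGraph.IsTree.degree_count_of_cover`), and it is optimal exactly for two non-adjacent
vertices of nearly equal degree with a common neighbour, which describes the double comet
(`SimpleGraph.IsTree.nonempty_iso_doubleComet`).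

With a matching of size three, interlacing bounds `λ₃` below by the third eigenvalue of the forest
induced on the six matched vertices. The adjacency matrix of that forest has determinant `-1`, so the
squares of its three positive eigenvalues have product `1`; together with their first two power sums
this gives `λ₃ ≥ 3 / 7` (`three_div_seven_le_adjEigenvalue`). So much of the trace is lost to `λ₃`
that `λ₁ + λ₂` stays below the value of the double comet, which misses `√(2 N)` only by a term of
order `N ^ (-3 / 2)` (`spectralSum_sq_lt_of_matching`). -/

open Matrix

/-! ### Eigenvalues in sorted order -/

section SortedEigenvalues

variable {V : Type*} [Fintype V] (G : SimpleGraph V)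

theorem adjEigenvalue_of_lt [DecidableEq V] [DecidableRel G.Adj] {i : ℕ}
    (h : i < Fintype.card V) :
    adjEigenvalue G i = (G.isHermitian_adjMatrix ℝ).eigenvalues₀ ⟨i, h⟩ := by
  rw [adjEigenvalue, dif_pos h]
  congr!

/-- The eigenvalues are the entries of the sorted list of roots of the characteristic polynomial;
this description does not mention the order of the graph. -/
theorem adjEigenvalue_eq_getD [DecidableEq V] [DecidableRel G.Adj] (i : ℕ) :
    adjEigenvalue G i = ((G.adjMatrix ℝ).charpoly.roots.sort (· ≥ ·)).getD i 0 := by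
  have h := (G.isHermitian_adjMatrix ℝ).sort_roots_charpoly_eq_eigenvalues₀
  have h' : (G.adjMatrix ℝ).charpoly.roots.map (RCLike.re : ℝ → ℝ)
      = (G.adjMatrix ℝ).charpoly.roots := by
    simp
  rw [h'] at h
  rw [h]
  by_cases hi : i < Fintype.card V
  · rw [adjEigenvalue_of_lt G hi, List.getD_eq_getElem _ _ (by simpa using hi)]
    simp
  · rw [adjEigenvalue, dif_neg hi, List.getD_eq_default _ _ (by simpa using hi)]

theorem adjEigenvalue_antitone {i j : ℕ} (hij : i ≤ j) (hj : j < Fintype.card V) :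
    adjEigenvalue G j ≤ adjEigenvalue G i := by
  classical
  rw [adjEigenvalue_of_lt G hj, adjEigenvalue_of_lt G (hij.trans_lt hj)]
  exact (G.isHermitian_adjMatrix ℝ).eigenvalues₀_antitone hij

theorem adjEigenvalue_congr {W : Type*} [Fintype W] {G : SimpleGraph V} {H : SimpleGraph W} (e : G ≃g H) (i : ℕ) :
    adjEigenvalue G i = adjEigenvalue H i := by
  classical
  rw [adjEigenvalue_eq_getD, adjEigenvalue_eq_getD, ← e.reindex_adjMatrix ℝ, charpoly_reindex]

/-- The spectrum of a bipartite graph is symmetric about `0`: conjugation by the sign matrix of a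
bipartition turns the adjacency matrix into its negative. -/
theorem adjEigenvalue_rev_of_isBipartite {G : SimpleGraph V} (hG : G.IsBipartite) {i j : ℕ}
    (hij : i + j + 1 = Fintype.card V) : adjEigenvalue G i = -adjEigenvalue G j := by
  classical
  obtain ⟨c⟩ := hG
  set A := G.adjMatrix ℝ with hA
  have hAh : A.IsHermitian := G.isHermitian_adjMatrix ℝ
  set s : V → ℝ := fun v => if c v = 0 then 1 else -1 with hs
  have hss : diagonal s * diagonal s = 1 := by
    rw [diagonal_mul_diagonal, ← diagonal_one]
    congr 1
    ext v
    simp only [hs]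
    split_ifs <;> norm_num
  have hneg : diagonal s * (A * diagonal s) = -A := by
    ext v w
    rw [diagonal_mul, mul_diagonal, Matrix.neg_apply, hA, SimpleGraph.adjMatrix_apply]
    by_cases hvw : G.Adj v w
    · have := c.valid hvw
      simp only [hs, hvw, if_true]
      generalize c v = a at *
      generalize c w = b at *
      fin_cases a <;> fin_cases b <;> simp_all
    · simp [hvw]
  have hchar : (-A).charpoly = A.charpoly := by
    rw [← hneg, charpoly_mul_comm, mul_assoc, hss, mul_one]
  have hchar2 : (-A).charpoly.roots = Multiset.map (fun x => -x) A.charpoly.roots := by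
    have h1 : -A = Unitary.conjStarAlgAut ℝ _ hAh.eigenvectorUnitary
        (diagonal fun i => -hAh.eigenvalues i) := by
      conv_lhs => rw [hAh.spectral_theorem, ← map_neg, diagonal_neg]
      rfl
    rw [h1, Unitary.conjStarAlgAut_apply, charpoly_mul_comm, ← mul_assoc]
    simp only [SetLike.coe_mem, Unitary.star_mul_self_of_mem, one_mul, charpoly_diagonal]
    rw [Polynomial.roots_prod, hAh.roots_charpoly_eq_eigenvalues]
    · simp
    · simp only [Finset.prod_ne_zero_iff]
      intro i _
      exact Polynomial.X_sub_C_ne_zero _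
  have hmul : A.charpoly.roots = Multiset.map hAh.eigenvalues₀ Finset.univ.val := by
    have := hAh.roots_charpoly_eq_eigenvalues₀
    simpa using this
  have hperm : (List.ofFn hAh.eigenvalues₀).Perm
      (List.ofFn fun k => -hAh.eigenvalues₀ (Fin.rev k)) := by
    rw [← Multiset.coe_eq_coe]
    have e1 : ((List.ofFn hAh.eigenvalues₀ : List ℝ) : Multiset ℝ) = A.charpoly.roots := by
      rw [hmul, Fin.univ_val_map]
    have e2 : ((List.ofFn (fun k => -hAh.eigenvalues₀ (Fin.rev k)) : List ℝ) : Multiset ℝ)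
        = Multiset.map (fun x => -x) A.charpoly.roots := by
      rw [hmul, ← Fin.univ_val_map, Multiset.map_map]
      have := congrArg Finset.val (Finset.univ_map_equiv_to_embedding
        (Fin.revPerm (n := Fintype.card V)))
      rw [Finset.map_val] at this
      conv_rhs => rw [← this]
      rw [Multiset.map_map]
      rfl
    rw [e1, e2, ← hchar2, hchar]
  have hsort : (List.ofFn fun k => -hAh.eigenvalues₀ (Fin.rev k)).SortedGE := by
    refine Antitone.sortedGE_ofFn ?_
    intro a b hab
    simp only [neg_le_neg_iff]
    exact hAh.eigenvalues₀_antitone (Fin.rev_le_rev.2 hab)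
  have := hperm.eq_of_sortedGE hAh.eigenvalues₀_antitone.sortedGE_ofFn hsort
  have := congrFun (List.ofFn_injective this) ⟨i, by omega⟩
  rw [adjEigenvalue_of_lt G (i := i) (by omega), adjEigenvalue_of_lt G (i := j) (by omega), this]
  congr 3
  ext
  simp only [Fin.val_rev]
  omega

theorem sum_adjEigenvalue_pow [DecidableEq V] [DecidableRel G.Adj] (k : ℕ) :
    ∑ i ∈ Finset.range (Fintype.card V), adjEigenvalue G i ^ k = (G.adjMatrix ℝ ^ k).trace := by
  have hA := G.isHermitian_adjMatrix ℝ
  conv_rhs => rw [hA.spectral_theorem, ← map_pow, Unitary.conjStarAlgAut_apply,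
    trace_mul_comm, ← mul_assoc]
  simp only [SetLike.coe_mem, Unitary.star_mul_self_of_mem, one_mul, diagonal_pow, trace_diagonal]
  rw [Finset.sum_range]
  refine (Fintype.sum_equiv (Fintype.equivOfCardEq (Fintype.card_fin _)) _ _ fun i => ?_)
  rw [adjEigenvalue_of_lt G i.2]
  simp [IsHermitian.eigenvalues]

theorem prod_adjEigenvalue [DecidableEq V] [DecidableRel G.Adj] :
    ∏ i ∈ Finset.range (Fintype.card V), adjEigenvalue G i = (G.adjMatrix ℝ).det := by
  have hA := G.isHermitian_adjMatrix ℝ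
  rw [hA.det_eq_prod_eigenvalues, Finset.prod_range]
  refine (Fintype.prod_equiv (Fintype.equivOfCardEq (Fintype.card_fin _)) _ _ fun i => ?_)
  rw [adjEigenvalue_of_lt G i.2]
  simp [IsHermitian.eigenvalues]

end SortedEigenvalues

/-! ### The min-max principle and interlacing -/

section MinMax

variable {V : Type*} [Fintype V] (G : SimpleGraph V) [DecidableRel G.Adj]

/-- Coordinates with respect to an orthonormal basis of eigenvectors, ordered as the eigenvalues. -/
theorem exists_eigencoordinates :
    ∃ P : (V → ℝ) ≃ₗ[ℝ] (Fin (Fintype.card V) → ℝ),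
      (∀ x, x ⬝ᵥ x = ∑ i, P x i ^ 2) ∧
      ∀ x, x ⬝ᵥ (G.adjMatrix ℝ *ᵥ x) = ∑ i : Fin (Fintype.card V), adjEigenvalue G i * P x i ^ 2 := by
  classical
  have hA := G.isHermitian_adjMatrix ℝ
  set b := (isSymmetric_toEuclideanLin_iff.mpr hA).eigenvectorBasis finrank_euclideanSpace with hb
  have hdot : ∀ x y : V → ℝ, x ⬝ᵥ y = ∑ i, inner ℝ (WithLp.toLp 2 x) (b i) *
      inner ℝ (b i) (WithLp.toLp 2 y) := by
    intro x y
    rw [b.sum_inner_mul_inner, EuclideanSpace.inner_toLp_toLp, dotProduct_comm]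
    simp
  refine ⟨(WithLp.linearEquiv 2 ℝ (V → ℝ)).symm ≪≫ₗ b.repr.toLinearEquiv ≪≫ₗ
    WithLp.linearEquiv 2 ℝ _, fun x => ?_, fun x => ?_⟩
  · rw [hdot]
    refine Finset.sum_congr rfl fun i _ => ?_
    rw [real_inner_comm, ← sq]
    simp [b.repr_apply_apply]
  · rw [hdot]
    refine Finset.sum_congr rfl fun i _ => ?_
    have h1 : inner ℝ (b i) (WithLp.toLp 2 (G.adjMatrix ℝ *ᵥ x)) =
        adjEigenvalue G i * inner ℝ (b i) (WithLp.toLp 2 x) := by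
      have h2 := (isSymmetric_toEuclideanLin_iff.mpr hA) (b i) (WithLp.toLp 2 x)
      rw [hb, LinearMap.IsSymmetric.apply_eigenvectorBasis, inner_smul_left] at h2
      rw [adjEigenvalue_of_lt G i.2]
      exact h2.symm
    rw [h1, real_inner_comm]
    simp [b.repr_apply_apply]
    ring

theorem le_adjEigenvalue {k : ℕ} (hk : k < Fintype.card V) {t : ℝ}
    (L : (Fin (k + 1) → ℝ) →ₗ[ℝ] (V → ℝ)) (hL : Function.Injective L)
    (h : ∀ y, t * (L y ⬝ᵥ L y) ≤ L y ⬝ᵥ (G.adjMatrix ℝ *ᵥ L y)) : t ≤ adjEigenvalue G k := by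
  obtain ⟨P, hP1, hP2⟩ := exists_eigencoordinates G
  let Q : (Fin (k + 1) → ℝ) →ₗ[ℝ] (Fin k → ℝ) :=
    (LinearMap.funLeft ℝ ℝ (Fin.castLE hk.le)) ∘ₗ P.toLinearMap ∘ₗ L
  have hker : LinearMap.ker Q ≠ ⊥ := LinearMap.ker_ne_bot_of_finrank_lt (by simp)
  obtain ⟨y, hy, hy0⟩ := (Submodule.ne_bot_iff _).1 hker
  have hc : ∀ i : Fin (Fintype.card V), i.val < k → P (L y) i = 0 := by
    intro i hi
    have := congrFun (LinearMap.mem_ker.1 hy) ⟨i, hi⟩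
    exact this
  have hpos : 0 < L y ⬝ᵥ L y := by
    refine lt_of_le_of_ne (Finset.sum_nonneg fun i _ => mul_self_nonneg _) fun h0 => hy0 (hL ?_)
    rw [dotProduct_self_eq_zero.1 h0.symm, map_zero]
  have hle : L y ⬝ᵥ (G.adjMatrix ℝ *ᵥ L y) ≤ adjEigenvalue G k * (L y ⬝ᵥ L y) := by
    rw [hP1, hP2, Finset.mul_sum]
    refine Finset.sum_le_sum fun i _ => ?_
    by_cases hi : i.val < k
    · simp [hc i hi]
    · exact mul_le_mul_of_nonneg_right (adjEigenvalue_antitone G (not_lt.1 hi) i.2) (sq_nonneg _)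
  exact le_of_mul_le_mul_right ((h y).trans hle) hpos

theorem exists_le_adjEigenvalue {k : ℕ} (hk : k < Fintype.card V) :
    ∃ L : (Fin (k + 1) → ℝ) →ₗ[ℝ] (V → ℝ), Function.Injective L ∧
      ∀ y, adjEigenvalue G k * (L y ⬝ᵥ L y) ≤ L y ⬝ᵥ (G.adjMatrix ℝ *ᵥ L y) := by
  obtain ⟨P, hP1, hP2⟩ := exists_eigencoordinates G
  let E : (Fin (k + 1) → ℝ) →ₗ[ℝ] (Fin (Fintype.card V) → ℝ) :=
    { toFun := fun y i => if h : i.val < k + 1 then y ⟨i, h⟩ else 0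
      map_add' := by
        intro x y
        ext i
        by_cases h : i.val < k + 1 <;> simp [-Order.lt_add_one_iff, h]
      map_smul' := by
        intro c y
        ext i
        by_cases h : i.val < k + 1 <;> simp [-Order.lt_add_one_iff, h] }
  refine ⟨P.symm.toLinearMap ∘ₗ E, ?_, fun y => ?_⟩
  · refine P.symm.injective.comp fun x y hxy => ?_
    ext i
    have := congrFun hxy ⟨i, by omega⟩
    simpa [-Order.lt_add_one_iff, E] using this
  · rw [hP1, hP2, Finset.mul_sum]
    refine Finset.sum_le_sum fun i _ => ?_
    simp only [LinearMap.comp_apply, LinearEquiv.coe_coe, LinearEquiv.apply_symm_apply]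
    by_cases hi : i.val < k + 1
    · exact mul_le_mul_of_nonneg_right (adjEigenvalue_antitone G (by omega) hk) (sq_nonneg _)
    · simp [-Order.lt_add_one_iff, E, hi]

/-- Interlacing: the eigenvalues of an induced subgraph are at most the eigenvalues of the same
index of the whole graph. -/
theorem adjEigenvalue_le_of_embedding {W : Type*} [Fintype W] (F : SimpleGraph W) (f : F ↪g G)
    {k : ℕ} (hk : k < Fintype.card W) : adjEigenvalue F k ≤ adjEigenvalue G k := by
  classical
  obtain ⟨L, hL, h⟩ := exists_le_adjEigenvalue F hk
  have hkV : k < Fintype.card V := hk.trans_le (Fintype.card_le_of_injective f f.injective)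
  let E : (W → ℝ) →ₗ[ℝ] (V → ℝ) := Function.ExtendByZero.linearMap ℝ f
  have hE : ∀ x w, E x (f w) = x w := fun x w => f.injective.extend_apply _ _ _
  have hE0 : ∀ x v, v ∉ Set.range f → E x v = 0 := fun x v hv =>
    Function.extend_apply' _ _ _ (by simpa using hv)
  have hsum : ∀ g : V → ℝ, (∀ v, v ∉ Set.range f → g v = 0) → ∑ v, g v = ∑ w, g (f w) := by
    intro g hg
    rw [← Finset.sum_image (s := Finset.univ) (g := f) (fun a _ b _ h => f.injective h)]
    refine (Finset.sum_subset (Finset.subset_univ _) fun v _ hv => hg v ?_).symm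
    simpa using hv
  have hEinj : Function.Injective E := by
    intro x y hxy
    ext w
    rw [← hE x, ← hE y, hxy]
  refine le_adjEigenvalue G hkV (E ∘ₗ L) (hEinj.comp hL) fun y => ?_
  · have e1 : (E (L y)) ⬝ᵥ (E (L y)) = L y ⬝ᵥ L y := by
      rw [dotProduct, hsum _ fun v hv => by rw [hE0 _ v hv, zero_mul]]
      simp [dotProduct, hE]
    have e2 : (E (L y)) ⬝ᵥ (G.adjMatrix ℝ *ᵥ E (L y)) = L y ⬝ᵥ (F.adjMatrix ℝ *ᵥ L y) := by
      rw [dotProduct, hsum _ fun v hv => by rw [hE0 _ v hv, zero_mul]]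
      refine Finset.sum_congr rfl fun w _ => ?_
      rw [hE, mulVec, dotProduct, hsum _ fun v hv => by rw [hE0 _ v hv, mul_zero]]
      simp [mulVec, dotProduct, hE, SimpleGraph.adjMatrix_apply]
    simp only [LinearMap.comp_apply]
    rw [e1, e2]
    exact h y

/-- If two vertices cover all edges, then the quadratic form of the adjacency matrix vanishes on a
subspace of codimension two, and so the third eigenvalue is not positive. -/
theorem adjEigenvalue_two_nonpos {u w : V} (hcov : ∀ x y, G.Adj x y → x = u ∨ x = w ∨ y = u ∨ y = w)
    (hV : 2 < Fintype.card V) : adjEigenvalue G 2 ≤ 0 := by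
  obtain ⟨L, hL, h⟩ := exists_le_adjEigenvalue G hV
  let Q : (Fin (2 + 1) → ℝ) →ₗ[ℝ] (Fin 2 → ℝ) := (LinearMap.funLeft ℝ ℝ ![u, w]) ∘ₗ L
  have hker : LinearMap.ker Q ≠ ⊥ := LinearMap.ker_ne_bot_of_finrank_lt (by simp)
  obtain ⟨y, hy, hy0⟩ := (Submodule.ne_bot_iff _).1 hker
  have hu : L y u = 0 := congrFun (LinearMap.mem_ker.1 hy) 0
  have hw : L y w = 0 := congrFun (LinearMap.mem_ker.1 hy) 1
  have hpos : 0 < L y ⬝ᵥ L y := by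
    refine lt_of_le_of_ne (Finset.sum_nonneg fun i _ => mul_self_nonneg _) fun h0 => hy0 (hL ?_)
    rw [dotProduct_self_eq_zero.1 h0.symm, map_zero]
  have h0 : L y ⬝ᵥ (G.adjMatrix ℝ *ᵥ L y) = 0 := by
    rw [SimpleGraph.dotProduct_mulVec_adjMatrix]
    refine Finset.sum_eq_zero fun i _ => Finset.sum_eq_zero fun j _ => ?_
    split_ifs with hij
    · rcases hcov i j hij with rfl | rfl | rfl | rfl <;> simp [hu, hw]
    · rfl
  have := h y
  rw [h0] at this
  exact nonpos_of_mul_nonpos_left this hpos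

end MinMax

/-! ### Closed walks of lengths two and four -/

section ClosedWalks

variable {V : Type*} [Fintype V] (G : SimpleGraph V) [DecidableRel G.Adj]

theorem adjMatrix_mul_self_apply [DecidableEq V] (i j : V) :
    (G.adjMatrix ℝ * G.adjMatrix ℝ) i j =
      ((G.neighborFinset i ∩ G.neighborFinset j).card : ℝ) := by
  rw [SimpleGraph.adjMatrix_mul_apply]
  simp only [SimpleGraph.adjMatrix_apply, Finset.sum_boole]
  congr 2
  ext k
  simp [SimpleGraph.adj_comm]

theorem trace_adjMatrix_sq [DecidableEq V] :
    (G.adjMatrix ℝ ^ 2).trace = ∑ v, (G.degree v : ℝ) := by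
  rw [sq, trace]
  exact Finset.sum_congr rfl fun v _ => by rw [diag_apply, G.adjMatrix_mul_self_apply_self]

theorem sum_adjMatrix_mul_self [DecidableEq V] :
    ∑ i, ∑ j, (G.adjMatrix ℝ * G.adjMatrix ℝ) i j = ∑ v, (G.degree v : ℝ) ^ 2 := by
  have h : ∀ v, ∑ i, G.adjMatrix ℝ i v = G.degree v := fun v => by
    simp [SimpleGraph.adjMatrix_apply, G.adj_comm, ← SimpleGraph.card_neighborFinset_eq_degree,
      SimpleGraph.neighborFinset_eq_filter]
  have h' : ∀ v, ∑ i, G.adjMatrix ℝ v i = G.degree v := fun v => by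
    rw [← h]
    exact Finset.sum_congr rfl fun i _ => by simp [SimpleGraph.adjMatrix_apply, G.adj_comm]
  simp only [mul_apply]
  calc _ = ∑ i, ∑ k, ∑ j, G.adjMatrix ℝ i k * G.adjMatrix ℝ k j :=
        Finset.sum_congr rfl fun i _ => Finset.sum_comm
    _ = ∑ k, ∑ i, ∑ j, G.adjMatrix ℝ i k * G.adjMatrix ℝ k j := Finset.sum_comm
    _ = _ := Finset.sum_congr rfl fun k _ => by
        simp only [← Finset.mul_sum, h', ← Finset.sum_mul, h, sq]

theorem trace_adjMatrix_pow_four [DecidableEq V] :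
    (G.adjMatrix ℝ ^ 4).trace =
      2 * ∑ v, (G.degree v : ℝ) ^ 2 - ∑ v, (G.degree v : ℝ) +
      ∑ i, ∑ j, if i = j then 0 else ((G.adjMatrix ℝ * G.adjMatrix ℝ) i j ^ 2 -
        (G.adjMatrix ℝ * G.adjMatrix ℝ) i j) := by
  set B := G.adjMatrix ℝ * G.adjMatrix ℝ with hB
  have hsymm : ∀ i j, B i j = B j i := fun i j => by
    simp only [hB, adjMatrix_mul_self_apply, Finset.inter_comm]
  have hdiag : ∀ i, B i i = G.degree i := fun i => G.adjMatrix_mul_self_apply_self i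
  have h1 : (G.adjMatrix ℝ ^ 4).trace = ∑ i, ∑ j, B i j ^ 2 := by
    rw [show G.adjMatrix ℝ ^ 4 = B * B by rw [hB, ← sq, ← sq, ← pow_mul], trace]
    refine Finset.sum_congr rfl fun i _ => ?_
    rw [diag_apply, mul_apply]
    exact Finset.sum_congr rfl fun j _ => by rw [hsymm j i, sq]
  have h2 : ∀ i, ∑ j, B i j ^ 2 = ∑ j, B i j + (G.degree i ^ 2 - G.degree i) +
      ∑ j, if i = j then 0 else (B i j ^ 2 - B i j) := by
    intro i
    have : (G.degree i : ℝ) ^ 2 - G.degree i =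
        ∑ j, if i = j then (G.degree i : ℝ) ^ 2 - G.degree i else 0 := by simp
    rw [this, ← Finset.sum_add_distrib, ← Finset.sum_add_distrib]
    refine Finset.sum_congr rfl fun j _ => ?_
    split_ifs with hij
    · subst hij
      rw [hdiag]
      ring
    · ring
  rw [h1, Finset.sum_congr rfl fun i _ => h2 i, Finset.sum_add_distrib, Finset.sum_add_distrib,
    sum_adjMatrix_mul_self, Finset.sum_sub_distrib]
  ring

theorem le_trace_adjMatrix_pow_four [DecidableEq V] :
    2 * ∑ v, (G.degree v : ℝ) ^ 2 - ∑ v, (G.degree v : ℝ) ≤ (G.adjMatrix ℝ ^ 4).trace := by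
  rw [trace_adjMatrix_pow_four]
  refine le_add_of_nonneg_right (Finset.sum_nonneg fun i _ => Finset.sum_nonneg fun j _ => ?_)
  split_ifs
  · exact le_rfl
  · rw [adjMatrix_mul_self_apply, sub_nonneg]
    exact_mod_cast Nat.le_self_pow two_ne_zero _

theorem SimpleGraph.IsAcyclic.eq_of_common_neighbor {V : Type*} {G : SimpleGraph V}
    (hG : G.IsAcyclic) {i j k l : V} (hij : i ≠ j) (hik : G.Adj i k) (hkj : G.Adj k j)
    (hil : G.Adj i l) (hlj : G.Adj l j) : k = l := by
  let p : G.Path i j := ⟨.cons hik (.cons hkj .nil), by simp [hik.ne, hkj.ne, hij]⟩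
  let q : G.Path i j := ⟨.cons hil (.cons hlj .nil), by simp [hil.ne, hlj.ne, hij]⟩
  have h : (p : G.Walk i j).support = (q : G.Walk i j).support := by
    rw [(hG.subsingleton_path i j).elim p q]
  simpa [p, q] using h

/-- In a forest two distinct vertices have at most one common neighbour, so closed walks of length
four are counted by the degrees alone. -/
theorem SimpleGraph.IsAcyclic.trace_adjMatrix_pow_four [DecidableEq V] {G : SimpleGraph V}
    [DecidableRel G.Adj] (hG : G.IsAcyclic) :
    (G.adjMatrix ℝ ^ 4).trace =
      2 * ∑ v, (G.degree v : ℝ) ^ 2 - ∑ v, (G.degree v : ℝ) := by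
  rw [_root_.trace_adjMatrix_pow_four, add_eq_left]
  refine Finset.sum_eq_zero fun i _ => Finset.sum_eq_zero fun j _ => ?_
  split_ifs with hij
  · rfl
  · have h : (G.neighborFinset i ∩ G.neighborFinset j).card ≤ 1 := by
      refine Finset.card_le_one.2 fun k hk l hl => ?_
      simp only [Finset.mem_inter, SimpleGraph.mem_neighborFinset] at hk hl
      exact hG.eq_of_common_neighbor hij hk.1 hk.2.symm hl.1 hl.2.symm
    rw [adjMatrix_mul_self_apply]
    interval_cases (G.neighborFinset i ∩ G.neighborFinset j).card <;> norm_num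

theorem three_mul_sum_degree_le :
    3 * ∑ v, (G.degree v : ℝ) - 2 * Fintype.card V ≤ ∑ v, (G.degree v : ℝ) ^ 2 := by
  have h : ∀ v, 3 * (G.degree v : ℝ) - 2 ≤ (G.degree v : ℝ) ^ 2 := by
    intro v
    rcases Nat.lt_or_ge (G.degree v) 2 with h | h
    · interval_cases G.degree v <;> norm_num
    · have h2 : (2 : ℝ) ≤ G.degree v := by exact_mod_cast h
      nlinarith
  have := Finset.sum_le_sum fun v (_ : v ∈ Finset.univ) => h v
  simp only [Finset.sum_sub_distrib, ← Finset.mul_sum, Finset.sum_const, Finset.card_univ,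
    nsmul_eq_mul] at this
  linarith

theorem SimpleGraph.IsTree.sum_degree_eq {G : SimpleGraph V} [DecidableRel G.Adj] (hG : G.IsTree) :
    ∑ v, (G.degree v : ℝ) = 2 * (Fintype.card V - 1) := by
  have h1 := G.sum_degrees_eq_twice_card_edges
  have h2 := hG.card_edgeFinset
  have h3 : ((∑ v, G.degree v : ℕ) : ℝ) = 2 * G.edgeFinset.card := by rw [h1]; push_cast; rfl
  rw [← h2]
  push_cast at h3 ⊢
  linarith

theorem SimpleGraph.IsAcyclic.card_edgeFinset_lt [Nonempty V] {G : SimpleGraph V}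
    [DecidableRel G.Adj] (hG : G.IsAcyclic) : G.edgeFinset.card < Fintype.card V := by
  classical
  obtain ⟨T, hle, -, hT⟩ := SimpleGraph.connected_top.exists_isTree_le_of_le_of_isAcyclic
    (le_top : G ≤ ⊤) hG
  rw [← hT.card_edgeFinset, Nat.lt_succ_iff]
  exact Finset.card_le_card (SimpleGraph.edgeFinset_mono hle)

end ClosedWalks

/-! ### Power sums of a symmetric spectrum -/

section BipartiteSpectrum

variable {V : Type*} [Fintype V] {G : SimpleGraph V}

theorem adjEigenvalue_nonneg (hG : G.IsBipartite) {i : ℕ} (hi : 2 * i < Fintype.card V) :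
    0 ≤ adjEigenvalue G i := by
  have h1 := adjEigenvalue_rev_of_isBipartite hG (i := i) (j := Fintype.card V - 1 - i) (by omega)
  have h2 := adjEigenvalue_antitone G (i := i) (j := Fintype.card V - 1 - i) (by omega) (by omega)
  linarith

variable [DecidableRel G.Adj]

theorem sum_sq_adjEigenvalue_le (hG : G.IsBipartite) (hV : 6 ≤ Fintype.card V) :
    2 * (adjEigenvalue G 0 ^ 2 + adjEigenvalue G 1 ^ 2 + adjEigenvalue G 2 ^ 2) ≤
      ∑ v, (G.degree v : ℝ) := by
  classical
  rw [← trace_adjMatrix_sq, ← sum_adjEigenvalue_pow]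
  obtain ⟨m, hm⟩ := Nat.exists_eq_add_of_le' hV
  have h0 := adjEigenvalue_rev_of_isBipartite hG (i := m + 5) (j := 0) (by omega)
  have h1 := adjEigenvalue_rev_of_isBipartite hG (i := m + 4) (j := 1) (by omega)
  have h2 := adjEigenvalue_rev_of_isBipartite hG (i := m + 3) (j := 2) (by omega)
  have h3 : 0 ≤ ∑ i ∈ Finset.range m, adjEigenvalue G (i + 3) ^ 2 :=
    Finset.sum_nonneg fun i _ => sq_nonneg _
  rw [hm]
  simp only [Finset.sum_range_succ _ (m + 5), Finset.sum_range_succ _ (m + 4),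
    Finset.sum_range_succ _ (m + 3), Finset.sum_range_succ', h0, h1, h2, zero_add,
    Nat.add_assoc, Nat.reduceAdd]
  linarith

theorem sum_adjEigenvalue_pow_of_card_eq_six (hG : G.IsBipartite) (hV : Fintype.card V = 6)
    [DecidableEq V] {k : ℕ} (hk : Even k) :
    2 * (adjEigenvalue G 0 ^ k + adjEigenvalue G 1 ^ k + adjEigenvalue G 2 ^ k) =
      (G.adjMatrix ℝ ^ k).trace := by
  rw [← sum_adjEigenvalue_pow, hV]
  have h0 := adjEigenvalue_rev_of_isBipartite hG (i := 5) (j := 0) (by omega)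
  have h1 := adjEigenvalue_rev_of_isBipartite hG (i := 4) (j := 1) (by omega)
  have h2 := adjEigenvalue_rev_of_isBipartite hG (i := 3) (j := 2) (by omega)
  simp only [Finset.sum_range_succ, Finset.sum_range_zero, h0, h1, h2, hk.neg_pow]
  ring

theorem sq_mul_adjEigenvalue_of_card_eq_six (hG : G.IsBipartite) (hV : Fintype.card V = 6)
    [DecidableEq V] :
    (adjEigenvalue G 0 * adjEigenvalue G 1 * adjEigenvalue G 2) ^ 2 =
      -(G.adjMatrix ℝ).det := by
  rw [← prod_adjEigenvalue, hV]
  have h0 := adjEigenvalue_rev_of_isBipartite hG (i := 5) (j := 0) (by omega)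
  have h1 := adjEigenvalue_rev_of_isBipartite hG (i := 4) (j := 1) (by omega)
  have h2 := adjEigenvalue_rev_of_isBipartite hG (i := 3) (j := 2) (by omega)
  simp only [Finset.prod_range_succ, Finset.prod_range_zero, h0, h1, h2]
  ring

theorem sum_adjEigenvalue_pow_of_nonpos (hG : G.IsBipartite) (hV : 4 ≤ Fintype.card V)
    (h : adjEigenvalue G 2 ≤ 0) [DecidableEq V] {k : ℕ} (hk : Even k) (hk0 : k ≠ 0) :
    2 * (adjEigenvalue G 0 ^ k + adjEigenvalue G 1 ^ k) = (G.adjMatrix ℝ ^ k).trace := by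
  rw [← sum_adjEigenvalue_pow]
  obtain ⟨m, hm⟩ := Nat.exists_eq_add_of_le' hV
  have h0 := adjEigenvalue_rev_of_isBipartite hG (i := m + 3) (j := 0) (by omega)
  have h1 := adjEigenvalue_rev_of_isBipartite hG (i := m + 2) (j := 1) (by omega)
  have hle : ∀ i, i < m → adjEigenvalue G (i + 2) ≤ 0 := fun i hi =>
    (adjEigenvalue_antitone G (by omega) (by omega)).trans h
  have h2 : ∑ i ∈ Finset.range m, adjEigenvalue G (i + 2) ^ k = 0 := by
    refine Finset.sum_eq_zero fun i hi => ?_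
    rw [Finset.mem_range] at hi
    have h3 := adjEigenvalue_rev_of_isBipartite hG (i := i + 2) (j := m - 1 - i + 2) (by omega)
    have h4 := hle i hi
    have h5 := hle (m - 1 - i) (by omega)
    rw [show adjEigenvalue G (i + 2) = 0 by linarith, zero_pow hk0]
  rw [hm]
  simp only [Finset.sum_range_succ _ (m + 3), Finset.sum_range_succ _ (m + 2),
    Finset.sum_range_succ', h0, h1, zero_add, Nat.add_assoc, Nat.reduceAdd, hk.neg_pow, h2]
  ring

end BipartiteSpectrum

/-! ### Forests with a matching of size three -/

section ThreeMatching

variable {V : Type*}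

theorem SimpleGraph.IsAcyclic.exists_leaf_of_adj [Finite V] {G : SimpleGraph V} (hG : G.IsAcyclic)
    {a b : V} (hab : G.Adj a b) : ∃ l u, G.Adj l u ∧ ∀ x, G.Adj l x → x = u := by
  classical
  have := Fintype.ofFinite V
  have : Nonempty V := ⟨a⟩
  obtain ⟨u, v, p, hp, hmax⟩ := SimpleGraph.Walk.exists_isPath_forall_isPath_length_le_length G
  have hnil : ¬p.Nil := by
    intro h
    have h1 := hmax a b (.cons hab .nil) (by simp [hab.ne])
    rw [SimpleGraph.Walk.length_eq_zero_iff.2 h] at h1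
    simp at h1
  refine ⟨u, _, p.adj_snd hnil, fun w hadj => hG.eq_snd_of_adj_start hp hadj ?_⟩
  by_contra hw
  have := hmax _ _ (p.cons hadj.symm) (hp.cons hw)
  simp at this

/-- A greedy form of Kőnig's theorem for forests: take the neighbour `u` of a leaf, then the
neighbour `w` of a leaf of the forest left when `u` is deleted. Either `u` and `w` cover all edges,
or an uncovered edge completes a matching of size three. The matching is recorded as a function on
`Fin 6`, whose values at `0` and `2` are the two leaves. -/
theorem SimpleGraph.IsAcyclic.exists_cover_or_matching [Finite V] [Nonempty V] {G : SimpleGraph V}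
    (hG : G.IsAcyclic) :
    (∃ u w, ∀ x y, G.Adj x y → x = u ∨ x = w ∨ y = u ∨ y = w) ∨
    ∃ f : Fin 6 → V, Function.Injective f ∧ G.Adj (f 0) (f 1) ∧ G.Adj (f 2) (f 3) ∧
      G.Adj (f 4) (f 5) ∧ (∀ x, G.Adj (f 0) x → x = f 1) ∧
      ∀ x, G.Adj (f 2) x → x = f 1 ∨ x = f 3 := by
  by_cases h1 : ∃ a b, G.Adj a b
  swap
  · obtain ⟨v⟩ := ‹Nonempty V›
    exact .inl ⟨v, v, fun x y h => absurd ⟨x, y, h⟩ h1⟩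
  obtain ⟨a, b, hab⟩ := h1
  obtain ⟨l, u, hlu, hl⟩ := hG.exists_leaf_of_adj hab
  by_cases h2 : ∃ a b, G.Adj a b ∧ a ≠ u ∧ b ≠ u
  swap
  · exact .inl ⟨u, u, fun x y h => by by_contra hc; exact h2 ⟨x, y, h, by tauto, by tauto⟩⟩
  obtain ⟨a, b, hab, ha, hb⟩ := h2
  obtain ⟨⟨l', hl'u⟩, ⟨w, hwu⟩, hl'w, hl'⟩ :=
    (hG.induce {x | x ≠ u}).exists_leaf_of_adj (a := ⟨a, ha⟩) (b := ⟨b, hb⟩) hab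
  by_cases h3 : ∀ x y, G.Adj x y → x = u ∨ x = w ∨ y = u ∨ y = w
  · exact .inl ⟨u, w, h3⟩
  push Not at h3
  obtain ⟨x, y, hxy, hxu, hxw, hyu, hyw⟩ := h3
  simp only [Set.mem_ofPred_eq] at hl'u hwu
  have hl'2 : ∀ z, G.Adj l' z → z = u ∨ z = w := fun z hz => by
    by_cases hzu : z = u
    · exact .inl hzu
    · exact .inr (congrArg Subtype.val (hl' ⟨z, hzu⟩ hz))
  have hl'w' : G.Adj l' w := hl'w
  refine .inr ⟨![l, u, l', w, x, y], ?_, hlu, hl'w', hxy, hl, hl'2⟩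
  have e1 : l ≠ u := hlu.ne
  have e2 : l ≠ l' := fun h => hwu (hl _ (h ▸ hl'w'))
  have e3 : l ≠ w := fun h => hl'u (hl _ (h ▸ hl'w'.symm))
  have e4 : l ≠ x := fun h => hyu (hl _ (h ▸ hxy))
  have e5 : l ≠ y := fun h => hxu (hl _ (h ▸ hxy.symm))
  have e6 : l' ≠ w := hl'w'.ne
  have e7 : l' ≠ x := fun h => by rcases hl'2 _ (h ▸ hxy) with h | h <;> contradiction
  have e8 : l' ≠ y := fun h => by rcases hl'2 _ (h ▸ hxy.symm) with h | h <;> contradiction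
  have e9 : x ≠ y := hxy.ne
  refine List.nodup_ofFn.1 (?_ : [l, u, l', w, x, y].Nodup)
  simp [e1, e2, e3, e4, e5, e6, e7, e8, e9, Ne.symm hl'u, Ne.symm hwu, Ne.symm hxu, Ne.symm hyu,
    Ne.symm hxw, Ne.symm hyw]

theorem det_matching_adjacency (a b c d e g : ℝ) :
    (!![0, 1, 0, 0, 0, 0; 1, 0, a, b, c, d; 0, a, 0, 1, 0, 0;
      0, b, 1, 0, e, g; 0, c, 0, e, 0, 1; 0, d, 0, g, 1, 0] : Matrix (Fin 6) (Fin 6) ℝ).det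
      = -1 := by
  simp [det_succ_row_zero, Fin.sum_univ_succ, Fin.succAbove]

/-- With `x ≥ y ≥ z` the squares of the positive eigenvalues of a forest with `m` edges on six
vertices that has a perfect matching, the least of them is at least that of the path, whose value
`0.198…` exceeds `9 / 49`. -/
theorem nine_div_le_of_mul_eq_one {x y z : ℝ} {m : ℕ} (hx : 0 ≤ x) (hy : 0 ≤ y) (hz : 0 ≤ z)
    (hm : m ≤ 5) (h1 : x + y + z = m) (h2 : 5 * (m : ℝ) - 12 ≤ x ^ 2 + y ^ 2 + z ^ 2)
    (h3 : x * y * z = 1) : 9 / 49 ≤ z := by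
  have he : x * y + (x + y) * z ≤ ((m : ℝ) ^ 2 - 5 * m + 12) / 2 := by
    rw [← h1] at h2 ⊢
    nlinarith
  -- `z` is a root of the cubic whose roots are `x`, `y` and `z`.
  have hc : z ^ 3 - m * z ^ 2 + (x * y + (x + y) * z) * z - 1 = 0 := by
    rw [← h1, ← h3]
    ring
  have hle : 1 ≤ z ^ 3 - m * z ^ 2 + ((m : ℝ) ^ 2 - 5 * m + 12) / 2 * z := by
    nlinarith [mul_le_mul_of_nonneg_right he hz]
  by_contra! hlt
  have hz2 : z ^ 2 ≤ 9 / 49 * z := by nlinarith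
  have hz3 : z ^ 3 ≤ 9 / 49 * z ^ 2 := by nlinarith [sq_nonneg z]
  interval_cases m
  · norm_num at h1
    have : z = 0 := by linarith
    norm_num [this] at hle
  · norm_num at hle
    nlinarith [sq_nonneg z]
  · norm_num at hle
    nlinarith [sq_nonneg z]
  · norm_num at hle
    nlinarith [sq_nonneg z]
  · norm_num at hle
    nlinarith [sq_nonneg z]
  · norm_num at hle
    nlinarith [sq_nonneg z, sq_nonneg (z - 9 / 49)]

/-- A forest without a vertex cover of size two has third eigenvalue at least `3 / 7`. -/
theorem three_div_seven_le_adjEigenvalue [Fintype V] {G : SimpleGraph V} (hG : G.IsAcyclic)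
    {f : Fin 6 → V} (hf : Function.Injective f) (h01 : G.Adj (f 0) (f 1))
    (h23 : G.Adj (f 2) (f 3)) (h45 : G.Adj (f 4) (f 5)) (h0 : ∀ x, G.Adj (f 0) x → x = f 1)
    (h2 : ∀ x, G.Adj (f 2) x → x = f 1 ∨ x = f 3) : 3 / 7 ≤ adjEigenvalue G 2 := by
  classical
  let F : SimpleGraph (Fin 6) := G.comap f
  let φ : F ↪g G := ⟨⟨f, hf⟩, Iff.rfl⟩
  refine le_trans ?_ (adjEigenvalue_le_of_embedding G F φ (by simp))
  have hF : F.IsAcyclic := hG.embedding φ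
  have hdet : (F.adjMatrix ℝ).det = -1 := by
    have n0 : ∀ i, i ≠ 1 → ¬ F.Adj 0 i := fun i hi h => hi (hf (h0 _ h))
    have n2 : ∀ i, i ≠ 1 → i ≠ 3 → ¬ F.Adj 2 i := fun i hi hi' h =>
      (h2 _ h).elim (fun h => hi (hf h)) fun h => hi' (hf h)
    have n0' : ∀ i, i ≠ 1 → ¬ F.Adj i 0 := fun i hi h => n0 i hi h.symm
    have n2' : ∀ i, i ≠ 1 → i ≠ 3 → ¬ F.Adj i 2 := fun i hi hi' h => n2 i hi hi' h.symm
    rw [← det_matching_adjacency (F.adjMatrix ℝ 1 2) (F.adjMatrix ℝ 1 3) (F.adjMatrix ℝ 1 4)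
      (F.adjMatrix ℝ 1 5) (F.adjMatrix ℝ 3 4) (F.adjMatrix ℝ 3 5)]
    congr 1
    have a01 : F.Adj 0 1 := h01
    have a23 : F.Adj 2 3 := h23
    have a45 : F.Adj 4 5 := h45
    ext i j
    fin_cases i <;> fin_cases j <;>
      simp [SimpleGraph.adjMatrix_apply, a01, a23, a45, a01.symm, a23.symm, a45.symm, n0, n2,
        n0', n2', F.adj_comm 2 1, F.adj_comm 3 1, F.adj_comm 4 1, F.adj_comm 5 1, F.adj_comm 4 3,
        F.adj_comm 5 3]
  have hb := hF.isBipartite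
  have p0 := adjEigenvalue_nonneg hb (i := 0) (by simp)
  have p1 := adjEigenvalue_nonneg hb (i := 1) (by simp)
  have p2 := adjEigenvalue_nonneg hb (i := 2) (by simp)
  have s2 := sum_adjEigenvalue_pow_of_card_eq_six hb (by simp) even_two
  have s4 := sum_adjEigenvalue_pow_of_card_eq_six hb (by simp) (k := 4) (by decide)
  have sd := sq_mul_adjEigenvalue_of_card_eq_six hb (by simp)
  rw [hdet] at sd
  rw [trace_adjMatrix_sq] at s2
  have t4 := le_trace_adjMatrix_pow_four F
  have d2 := three_mul_sum_degree_le F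
  have hm : ∑ v, (F.degree v : ℝ) = 2 * F.edgeFinset.card := by
    exact_mod_cast F.sum_degrees_eq_twice_card_edges
  have hm5 : F.edgeFinset.card ≤ 5 := by
    have := hF.card_edgeFinset_lt
    simp only [Fintype.card_fin] at this
    omega
  rw [hm] at s2 t4 d2
  simp only [Fintype.card_fin] at d2
  push_cast at d2
  have := nine_div_le_of_mul_eq_one (sq_nonneg (adjEigenvalue F 0)) (sq_nonneg (adjEigenvalue F 1))
    (sq_nonneg (adjEigenvalue F 2)) hm5 (by linarith) (by nlinarith) (by nlinarith)
  nlinarith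

end ThreeMatching

/-! ### Trees with a vertex cover of size two -/

section VertexCover

variable {V : Type*} [Fintype V] {G : SimpleGraph V} [DecidableRel G.Adj]

/-- Degree count in a tree whose edges are covered by two vertices `u` and `w`: every other vertex
is a leaf, except for one common neighbour when `u` and `w` are not adjacent. -/
theorem SimpleGraph.IsTree.degree_count_of_cover (hG : G.IsTree) {u w : V} (huw : u ≠ w)
    (hcov : ∀ x y, G.Adj x y → x = u ∨ x = w ∨ y = u ∨ y = w) :
    (G.degree u + G.degree w = Fintype.card V ∧
      ∑ v, G.degree v ^ 2 + 2 = G.degree u ^ 2 + G.degree w ^ 2 + Fintype.card V) ∨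
    (¬ G.Adj u w ∧ (∃ c, G.Adj u c ∧ G.Adj w c) ∧
      G.degree u + G.degree w + 1 = Fintype.card V ∧
      ∑ v, G.degree v ^ 2 = G.degree u ^ 2 + G.degree w ^ 2 + Fintype.card V + 1) := by
  classical
  have : Nontrivial V := ⟨u, w, huw⟩
  let S : Finset V := (Finset.univ.erase u).erase w
  have hS : ∀ v ∈ S, v ≠ u ∧ v ≠ w := by
    intro v hv
    simp only [S, Finset.mem_erase, Finset.mem_univ, and_true] at hv
    exact ⟨hv.2, hv.1⟩
  have hsplit : ∀ g : V → ℕ, ∑ v, g v = g u + (g w + ∑ v ∈ S, g v) := fun g => by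
    rw [Finset.add_sum_erase _ g (by simp [huw.symm]), Finset.add_sum_erase _ g (by simp)]
  let iu : V → ℕ := fun v => if G.Adj u v then 1 else 0
  let iw : V → ℕ := fun v => if G.Adj w v then 1 else 0
  have hdeg : ∀ z, ∑ v, (if G.Adj z v then 1 else 0) = G.degree z := fun z => by
    rw [Finset.sum_boole, ← SimpleGraph.card_neighborFinset_eq_degree,
      SimpleGraph.neighborFinset_eq_filter]
    rfl
  have hd : ∀ v ∈ S, G.degree v = iu v + iw v := by
    intro v hv
    obtain ⟨hvu, hvw⟩ := hS v hv
    rw [← hdeg v, hsplit, Finset.sum_eq_zero, add_zero]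
    · simp only [iu, iw, G.adj_comm v]
    · intro z hz
      obtain ⟨hzu, hzw⟩ := hS z hz
      rw [if_neg]
      intro h
      rcases hcov v z h with h | h | h | h <;> contradiction
  have hd1 : ∀ v ∈ S, iu v + iw v = 1 + iu v * iw v := by
    intro v hv
    have h1 : 0 < G.degree v := hG.preconnected.degree_pos_of_nontrivial v
    rw [hd v hv] at h1
    simp only [iu, iw] at h1 ⊢
    split_ifs at h1 ⊢ <;> omega
  have hd2 : ∀ v ∈ S, G.degree v ^ 2 = 1 + 3 * (iu v * iw v) := by
    intro v hv
    rw [hd v hv, hd1 v hv]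
    simp only [iu, iw]
    split_ifs <;> norm_num
  have hSc : S.card + 2 = Fintype.card V := by
    have h := hsplit fun _ => 1
    simp only [Finset.sum_const, smul_eq_mul, mul_one, Finset.card_univ] at h
    omega
  obtain ⟨c, hc⟩ : ∃ c, ∑ v ∈ S, iu v * iw v = c := ⟨_, rfl⟩
  have hc_card : c = (S.filter fun v => G.Adj u v ∧ G.Adj w v).card := by
    rw [← hc, Finset.card_filter]
    refine Finset.sum_congr rfl fun v _ => ?_
    simp only [iu, iw]
    split_ifs <;> simp_all
  have hc1 : c ≤ 1 := by
    rw [hc_card]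
    refine Finset.card_le_one.2 fun k hk l hl => ?_
    simp only [Finset.mem_filter] at hk hl
    exact hG.isAcyclic.eq_of_common_neighbor huw hk.2.1 hk.2.2.symm hl.2.1 hl.2.2.symm
  have hsumd : ∑ v ∈ S, (iu v + iw v) = S.card + c := by
    rw [Finset.sum_congr rfl hd1, Finset.sum_add_distrib, hc]
    simp
  have hu := hsplit iu
  have hw := hsplit iw
  have hN : ∑ v, G.degree v + 2 = 2 * Fintype.card V := by
    rw [G.sum_degrees_eq_twice_card_edges, ← hG.card_edgeFinset]
    ring
  rw [hsplit, Finset.sum_congr rfl hd, hsumd] at hN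
  have hsq := hsplit fun v => G.degree v ^ 2
  rw [Finset.sum_congr rfl hd2, Finset.sum_add_distrib, ← Finset.mul_sum, hc] at hsq
  rw [Finset.sum_add_distrib] at hsumd
  simp only [iu, iw, hdeg, SimpleGraph.irrefl, if_false, G.adj_comm w u] at hu hw
  simp only [Finset.sum_const, smul_eq_mul, mul_one] at hsq
  by_cases huw' : G.Adj u w
  · left
    simp only [huw', if_true] at hu hw
    have : ∑ v ∈ S, (if G.Adj u v then 1 else 0) = ∑ v ∈ S, iu v := rfl
    have : ∑ v ∈ S, (if G.Adj w v then 1 else 0) = ∑ v ∈ S, iw v := rfl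
    constructor <;> omega
  · right
    simp only [huw', if_false] at hu hw
    have : ∑ v ∈ S, (if G.Adj u v then 1 else 0) = ∑ v ∈ S, iu v := rfl
    have : ∑ v ∈ S, (if G.Adj w v then 1 else 0) = ∑ v ∈ S, iw v := rfl
    have hc' : c = 1 := by omega
    obtain ⟨z, hz⟩ := Finset.card_pos.1 (by omega : 0 < (S.filter fun v =>
      G.Adj u v ∧ G.Adj w v).card)
    exact ⟨huw', ⟨z, (Finset.mem_filter.1 hz).2⟩, by omega, by omega⟩

/-- If two vertices cover the edges of a tree, then the spectral sum is determined by the order and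
the sum of the squared degrees. -/
theorem SimpleGraph.IsTree.spectralSum_sq_of_cover (hG : G.IsTree) (hV : 4 ≤ Fintype.card V)
    {u w : V} (hcov : ∀ x y, G.Adj x y → x = u ∨ x = w ∨ y = u ∨ y = w) {M : ℝ}
    (hM : 2 * M = ((Fintype.card V : ℝ) - 1) ^ 2 + (Fintype.card V - 1) -
      ∑ v, (G.degree v : ℝ) ^ 2) :
    0 ≤ M ∧ spectralSum G ^ 2 = (Fintype.card V - 1) + 2 * √M := by
  classical
  have hb := hG.isAcyclic.isBipartite
  have h2 := adjEigenvalue_two_nonpos G hcov (by omega)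
  have p0 := adjEigenvalue_nonneg hb (i := 0) (by omega)
  have p1 := adjEigenvalue_nonneg hb (i := 1) (by omega)
  have s2 := sum_adjEigenvalue_pow_of_nonpos hb hV h2 even_two two_ne_zero
  have s4 := sum_adjEigenvalue_pow_of_nonpos hb hV h2 (k := 4) (by decide) (by decide)
  rw [trace_adjMatrix_sq, hG.sum_degree_eq] at s2
  rw [hG.isAcyclic.trace_adjMatrix_pow_four, hG.sum_degree_eq] at s4
  have hMeq : M = (adjEigenvalue G 0 * adjEigenvalue G 1) ^ 2 := by
    have e : (Fintype.card V : ℝ) - 1 = adjEigenvalue G 0 ^ 2 + adjEigenvalue G 1 ^ 2 := by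
      linarith
    rw [e] at hM s4
    nlinarith
  refine ⟨hMeq ▸ sq_nonneg _, ?_⟩
  rw [hMeq, Real.sqrt_sq (mul_nonneg p0 p1), spectralSum]
  nlinarith

omit [DecidableRel G.Adj] in
theorem SimpleGraph.IsTree.spectralSum_nonneg (hG : G.IsTree) (hV : 3 ≤ Fintype.card V) :
    0 ≤ spectralSum G :=
  add_nonneg (adjEigenvalue_nonneg hG.isAcyclic.isBipartite (by omega))
    (adjEigenvalue_nonneg hG.isAcyclic.isBipartite (by omega))

end VertexCover

/-! ### Double comets on a path with three vertices -/

section DoubleComet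

/-- Two non-adjacent vertices that cover the edges of a tree and have a common neighbour: such a
tree is a double comet on a path with three vertices. -/
theorem SimpleGraph.IsTree.nonempty_iso_doubleComet {V : Type*} [Fintype V] {G : SimpleGraph V}
    [DecidableRel G.Adj] (hG : G.IsTree) {u w c : V} (huw : u ≠ w) (hadj : ¬ G.Adj u w)
    (hcov : ∀ x y, G.Adj x y → x = u ∨ x = w ∨ y = u ∨ y = w) (huc : G.Adj u c) (hwc : G.Adj w c)
    {a b : ℕ} (ha : G.degree u = a + 1) (hb : G.degree w = b + 1)
    (hV : Fintype.card V = a + b + 3) : Nonempty (G ≃g doubleComet a b 3) := by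
  classical
  have hA : ((G.neighborFinset u).erase c).card = a := by
    rw [Finset.card_erase_of_mem (by simpa using huc), G.card_neighborFinset_eq_degree, ha]
    rfl
  have hB : ((G.neighborFinset w).erase c).card = b := by
    rw [Finset.card_erase_of_mem (by simpa using hwc), G.card_neighborFinset_eq_degree, hb]
    rfl
  let eA := (Finset.equivFinOfCardEq hA).symm
  let eB := (Finset.equivFinOfCardEq hB).symm
  have pA : ∀ i, G.Adj u (eA i) ∧ (eA i : V) ≠ c := fun i => by
    have := (eA i).2
    simp only [Finset.mem_erase, SimpleGraph.mem_neighborFinset] at this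
    exact this.symm
  have pB : ∀ i, G.Adj w (eB i) ∧ (eB i : V) ≠ c := fun i => by
    have := (eB i).2
    simp only [Finset.mem_erase, SimpleGraph.mem_neighborFinset] at this
    exact this.symm
  have common : ∀ z, G.Adj u z → G.Adj w z → z = c := fun z h1 h2 =>
    hG.isAcyclic.eq_of_common_neighbor huw h1 h2.symm huc hwc.symm
  have nAw : ∀ i, ¬ G.Adj w (eA i) := fun i h => (pA i).2 (common _ (pA i).1 h)
  have nBu : ∀ i, ¬ G.Adj u (eB i) := fun i h => (pB i).2 (common _ h (pB i).1)
  have Au : ∀ i, (eA i : V) ≠ u := fun i => (pA i).1.ne'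
  have Aw : ∀ i, (eA i : V) ≠ w := fun i h => hadj (h ▸ (pA i).1)
  have Bw : ∀ i, (eB i : V) ≠ w := fun i => (pB i).1.ne'
  have Bu : ∀ i, (eB i : V) ≠ u := fun i h => hadj ((h ▸ (pB i).1).symm)
  have cu : c ≠ u := huc.ne'
  have cw : c ≠ w := hwc.ne'
  have AB : ∀ i j, (eA i : V) ≠ eB j := fun i j h => nAw i (h ▸ (pB j).1)
  have none : ∀ x y, x ≠ u → x ≠ w → y ≠ u → y ≠ w → ¬ G.Adj x y := fun x y h1 h2 h3 h4 h => by
    rcases hcov x y h with h | h | h | h <;> contradiction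
  let f : Fin a ⊕ Fin 3 ⊕ Fin b → V :=
    Sum.elim (fun i => eA i) (Sum.elim ![u, c, w] fun i => eB i)
  have hinj : Function.Injective f := by
    refine Function.Injective.sumElim (Subtype.val_injective.comp eA.injective)
      (Function.Injective.sumElim ?_ (Subtype.val_injective.comp eB.injective) ?_) ?_
    · intro i j hij
      fin_cases i <;> fin_cases j <;> simp_all
    · intro i j
      fin_cases i
      · exact (Bu j).symm
      · exact (pB j).2.symm
      · exact (Bw j).symm
    · rintro i (j | j)
      · fin_cases j
        · exact Au i
        · exact (pA i).2
        · exact Aw i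
      · exact AB i j
  have hbij : Function.Bijective f := by
    rw [Fintype.bijective_iff_injective_and_card]
    refine ⟨hinj, ?_⟩
    simp only [Fintype.card_sum, Fintype.card_fin, hV]
    ring
  refine ⟨SimpleGraph.Iso.symm ⟨Equiv.ofBijective f hbij, ?_⟩⟩
  have nAA : ∀ i j, ¬ G.Adj (eA i) (eA j) := fun i j => none _ _ (Au i) (Aw i) (Au j) (Aw j)
  have nBB : ∀ i j, ¬ G.Adj (eB i) (eB j) := fun i j => none _ _ (Bu i) (Bw i) (Bu j) (Bw j)
  have nAB : ∀ i j, ¬ G.Adj (eA i) (eB j) := fun i j => none _ _ (Au i) (Aw i) (Bu j) (Bw j)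
  have nAc : ∀ i, ¬ G.Adj (eA i) c := fun i => none _ _ (Au i) (Aw i) cu cw
  have nBc : ∀ i, ¬ G.Adj (eB i) c := fun i => none _ _ (Bu i) (Bw i) cu cw
  rintro (i | i | i) (j | j | j)
  · simpa [f, doubleComet] using nAA i j
  · fin_cases j
    · simpa [f, doubleComet] using (pA i).1.symm
    · simpa [f, doubleComet] using nAc i
    · simpa [f, doubleComet, G.adj_comm _ w] using nAw i
  · simpa [f, doubleComet] using nAB i j
  · fin_cases i
    · simpa [f, doubleComet] using (pA j).1
    · simpa [f, doubleComet, G.adj_comm c] using nAc j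
    · simpa [f, doubleComet] using nAw j
  · fin_cases i <;> fin_cases j <;>
      simp [f, doubleComet, huc, hwc, huc.symm, hwc.symm, hadj, G.adj_comm w u]
  · fin_cases i
    · simpa [f, doubleComet] using nBu j
    · simpa [f, doubleComet, G.adj_comm c] using nBc j
    · simpa [f, doubleComet] using (pB j).1
  · simpa [f, doubleComet, G.adj_comm _ (eA j : V)] using nAB j i
  · fin_cases j
    · simpa [f, doubleComet, G.adj_comm _ u] using nBu i
    · simpa [f, doubleComet] using nBc i
    · simpa [f, doubleComet] using (pB i).1.symm
  · simpa [f, doubleComet] using nBB i j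

theorem doubleComet_three_cover {a b : ℕ} (x y : Fin a ⊕ Fin 3 ⊕ Fin b)
    (h : (doubleComet a b 3).Adj x y) :
    x = .inr (.inl 0) ∨ x = .inr (.inl 2) ∨ y = .inr (.inl 0) ∨ y = .inr (.inl 2) := by
  rcases x with i | i | i
  · rcases y with j | j | j
    · simp [doubleComet] at h
    · exact .inr (.inr (.inl (congrArg (Sum.inr ∘ Sum.inl) (Fin.ext h))))
    · simp [doubleComet] at h
  · fin_cases i
    · exact .inl rfl
    · rcases y with j | j | j
      · simp [doubleComet] at h
      · fin_cases j
        · exact .inr (.inr (.inl rfl))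
        · simp [doubleComet] at h
        · exact .inr (.inr (.inr rfl))
      · simp [doubleComet] at h
    · exact .inr (.inl rfl)
  · rcases y with j | j | j
    · simp [doubleComet] at h
    · exact .inr (.inr (.inr (congrArg (Sum.inr ∘ Sum.inl) (Fin.ext (Nat.succ_injective h)))))
    · simp [doubleComet] at h

theorem doubleComet_three_degree {a b : ℕ} [DecidableRel (doubleComet a b 3).Adj]
    (v : Fin a ⊕ Fin 3 ⊕ Fin b) : (doubleComet a b 3).degree v =
      ∑ i, (if (doubleComet a b 3).Adj v (.inl i) then 1 else 0) +
      ((if (doubleComet a b 3).Adj v (.inr (.inl 0)) then 1 else 0) +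
        (if (doubleComet a b 3).Adj v (.inr (.inl 1)) then 1 else 0) +
        (if (doubleComet a b 3).Adj v (.inr (.inl 2)) then 1 else 0) +
      ∑ i, (if (doubleComet a b 3).Adj v (.inr (.inr i)) then 1 else 0)) := by
  rw [← SimpleGraph.card_neighborFinset_eq_degree, SimpleGraph.neighborFinset_eq_filter,
    Finset.card_filter, Fintype.sum_sum_type, Fintype.sum_sum_type, Fin.sum_univ_three]

theorem doubleComet_three_degree_left (a b : ℕ) [DecidableRel (doubleComet a b 3).Adj] :
    (doubleComet a b 3).degree (.inr (.inl 0)) = a + 1 := by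
  rw [doubleComet_three_degree]
  simp [doubleComet]

theorem doubleComet_three_degree_right (a b : ℕ) [DecidableRel (doubleComet a b 3).Adj] :
    (doubleComet a b 3).degree (.inr (.inl 2)) = b + 1 := by
  rw [doubleComet_three_degree]
  simp [doubleComet, add_comm]

theorem doubleComet_three_isTree (a b : ℕ) : (doubleComet a b 3).IsTree := by
  classical
  set H := doubleComet a b 3 with hH
  rw [SimpleGraph.isTree_iff_connected_and_card]
  have h01 : H.Adj (.inr (.inl 0)) (.inr (.inl 1)) := by simp [hH, doubleComet]
  have h21 : H.Adj (.inr (.inl 2)) (.inr (.inl 1)) := by simp [hH, doubleComet]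
  constructor
  · rw [SimpleGraph.connected_iff_exists_forall_reachable]
    refine ⟨.inr (.inl 1), ?_⟩
    rintro (i | i | i)
    · refine (SimpleGraph.Adj.reachable ?_).trans h01.reachable |>.symm
      simp [hH, doubleComet]
    · fin_cases i
      · exact h01.reachable.symm
      · exact .refl _
      · exact h21.reachable.symm
    · refine (SimpleGraph.Adj.reachable ?_).trans h21.reachable |>.symm
      simp [hH, doubleComet]
  · have hs := H.sum_degrees_eq_twice_card_edges
    have hd : ∑ v, H.degree v = 2 * (a + b + 2) := by
      rw [Fintype.sum_sum_type, Fintype.sum_sum_type, Fin.sum_univ_three,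
        doubleComet_three_degree_left, doubleComet_three_degree_right]
      have d0 : ∀ i, H.degree (.inl i) = 1 := fun i => by
        rw [doubleComet_three_degree]
        simp [doubleComet]
      have d1 : H.degree (.inr (.inl 1)) = 2 := by
        rw [doubleComet_three_degree]
        simp [doubleComet]
      have d2 : ∀ i, H.degree (.inr (.inr i)) = 1 := fun i => by
        rw [doubleComet_three_degree]
        simp [doubleComet]
      simp only [d0, d1, d2, Finset.sum_const, Finset.card_univ, Fintype.card_fin, smul_eq_mul]
      ring
    rw [Nat.card_eq_fintype_card, ← SimpleGraph.edgeFinset_card, Nat.card_eq_fintype_card]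
    simp only [Fintype.card_sum, Fintype.card_fin]
    omega

end DoubleComet

/-! ### Comparison of spectral sums -/

section Extremal

theorem doubleComet_three_spectralSum_sq (a b : ℕ) (hab : 1 ≤ a + b) :
    spectralSum (doubleComet a b 3) ^ 2 =
      ((a : ℝ) + b + 2) + 2 * √(((a : ℝ) + 1) * (b + 1) - 1) := by
  classical
  have hT := doubleComet_three_isTree a b
  have hV : Fintype.card (Fin a ⊕ Fin 3 ⊕ Fin b) = a + b + 3 := by
    simp only [Fintype.card_sum, Fintype.card_fin]
    ring
  have hcov := doubleComet_three_cover (a := a) (b := b)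
  have hd := hT.degree_count_of_cover (u := .inr (.inl 0)) (w := .inr (.inl 2)) (by simp) hcov
  rw [hV, doubleComet_three_degree_left, doubleComet_three_degree_right] at hd
  rcases hd with ⟨h, -⟩ | ⟨-, -, -, h⟩
  · omega
  have h' : ∑ v, ((doubleComet a b 3).degree v : ℝ) ^ 2 =
      ((a : ℝ) + 1) ^ 2 + (b + 1) ^ 2 + (a + b + 3) + 1 := by exact_mod_cast h
  have := (hT.spectralSum_sq_of_cover (by omega) hcov (M := ((a : ℝ) + 1) * (b + 1) - 1) (by
    rw [h', hV]
    push_cast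
    ring)).2
  rw [this, hV]
  push_cast
  ring

/-- A tree with `λ₃ ≥ 3 / 7`, as any tree without a vertex cover of size two has. In the application
`N` is the number of edges and `M = λ₁² λ₂²` for the extremal double comet with as many edges, which
is `(N² - 4) / 4` or `(N² - 5) / 4` according to the parity of `N`. With at least six edges it is
enough that `(λ₁ + λ₂)² ≤ 2 (λ₁² + λ₂²) ≤ 2 (N - λ₃²)`, together with `4 M ≥ N² - 5` for `N ≥ 7` and
the exact value of `M` for `N = 6`. -/
theorem spectralSum_sq_lt_of_matching {V : Type*} [Fintype V] {G : SimpleGraph V} (hG : G.IsTree)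
    (h3 : 3 / 7 ≤ adjEigenvalue G 2) {N M : ℕ} (hV : Fintype.card V = N + 1) (hN : 5 ≤ N)
    (hM : N ^ 2 ≤ 4 * M + 5) (hM' : N = 6 → M = 8) :
    spectralSum G ^ 2 < N + 2 * √(M : ℝ) := by
  classical
  have hb := hG.isAcyclic.isBipartite
  have p0 := adjEigenvalue_nonneg hb (i := 0) (by omega)
  have p1 := adjEigenvalue_nonneg hb (i := 1) (by omega)
  have hr : 9 / 49 ≤ adjEigenvalue G 2 ^ 2 := by nlinarith
  have hdeg := hG.sum_degree_eq
  have hVR : (Fintype.card V : ℝ) - 1 = N := by rw [hV]; push_cast; ring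
  rw [hVR] at hdeg
  have hMR : (N : ℝ) ^ 2 ≤ 4 * M + 5 := by exact_mod_cast hM
  rcases hN.eq_or_lt with rfl | hN6
  · -- On six vertices the fourth moment bounds the product of the two largest eigenvalues.
    have s2 := sum_adjEigenvalue_pow_of_card_eq_six hb (by omega) even_two
    have s4 := sum_adjEigenvalue_pow_of_card_eq_six hb (by omega) (k := 4) (by decide)
    rw [trace_adjMatrix_sq, hdeg] at s2
    have t4 := le_trace_adjMatrix_pow_four G
    have d2 := three_mul_sum_degree_le G
    rw [hdeg] at t4 d2
    rw [hV] at d2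
    push_cast at *
    have hord := adjEigenvalue_antitone G (i := 1) (j := 2) (by omega) (by omega)
    have hord' := adjEigenvalue_antitone G (i := 0) (j := 1) (by omega) (by omega)
    have hM5 : (5 : ℝ) ≤ M := by linarith
    have hs2 : 2 ≤ √(M : ℝ) := Real.le_sqrt_of_sq_le (by linarith)
    have hsq := Real.sq_sqrt (show (0 : ℝ) ≤ M by linarith)
    rw [spectralSum]
    generalize adjEigenvalue G 0 = x at *
    generalize adjEigenvalue G 1 = y at *
    generalize adjEigenvalue G 2 = z at *
    generalize √(M : ℝ) = s at *
    have hz3 : 3 * z ^ 2 ≤ 5 := by nlinarith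
    have hxy : (x * y) ^ 2 ≤ 6 - 5 * z ^ 2 + (z ^ 2) ^ 2 := by
      have e : x ^ 2 + y ^ 2 = 5 - z ^ 2 := by linarith
      have e4 : 13 ≤ x ^ 4 + y ^ 4 + z ^ 4 := by linarith
      have : (x ^ 2 + y ^ 2) ^ 2 = (5 - z ^ 2) ^ 2 := by rw [e]
      nlinarith
    -- Now `(x + y) ^ 2 = 5 - z ^ 2 + 2 x y`, so this is the required bound.
    have hlt : x * y < s + z ^ 2 / 2 := by
      refine lt_of_pow_lt_pow_left₀ 2 (by positivity) ?_
      nlinarith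
    nlinarith
  · have s2 := sum_sq_adjEigenvalue_le hb (by omega)
    rw [hdeg] at s2
    have hle : spectralSum G ^ 2 ≤ 2 * N - 18 / 49 := by
      rw [spectralSum]
      nlinarith [sq_nonneg (adjEigenvalue G 0 - adjEigenvalue G 1)]
    have hlt : ((N : ℝ) - 18 / 49) / 2 < √(M : ℝ) := by
      refine Real.lt_sqrt_of_sq_lt ?_
      rcases (show N = 6 ∨ 7 ≤ N by omega) with rfl | h7
      · rw [hM' rfl]
        norm_num
      · have : (7 : ℝ) ≤ N := by exact_mod_cast h7
        nlinarith
    linarith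

/-- For a tree with a cover by two vertices of degrees `p` and `q`, the product `λ₁² λ₂²` is
`(p - 1) (q - 1)` with `p + q = a + b + 3` if they are adjacent, and `p q - 1` with
`p + q = a + b + 2` otherwise. The maximum `(a + 1) (b + 1) - 1` needs the second case and the
balanced pair of degrees. -/
theorem SimpleGraph.IsTree.spectralSum_sq_lt_or_iso_of_cover {V : Type*} [Fintype V]
    {G : SimpleGraph V} (hG : G.IsTree) {a b : ℕ} (hab : 2 ≤ a + b) (hba : b = a ∨ b = a + 1)
    (hV : Fintype.card V = a + b + 3) {u w : V} (huw : u ≠ w)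
    (hcov : ∀ x y, G.Adj x y → x = u ∨ x = w ∨ y = u ∨ y = w) :
    spectralSum G ^ 2 < ((a : ℝ) + b + 2) + 2 * √(((a : ℝ) + 1) * (b + 1) - 1) ∨
      Nonempty (G ≃g doubleComet a b 3) := by
  classical
  have hVR : (Fintype.card V : ℝ) - 1 = a + b + 2 := by rw [hV]; push_cast; ring
  rcases hG.degree_count_of_cover huw hcov with ⟨h1, h2⟩ | ⟨hadj, ⟨c, huc, hwc⟩, h1, h2⟩
  · left
    have h1R : (G.degree u : ℝ) + G.degree w = a + b + 3 := by
      rw [hV] at h1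
      exact_mod_cast h1
    have h2R : ∑ v, (G.degree v : ℝ) ^ 2 + 2 =
        (G.degree u : ℝ) ^ 2 + G.degree w ^ 2 + (a + b + 3) := by
      rw [hV] at h2
      exact_mod_cast h2
    obtain ⟨hM, hs⟩ := hG.spectralSum_sq_of_cover (by omega) hcov
      (M := ((G.degree u : ℝ) - 1) * (G.degree w - 1)) (by
        rw [hVR]
        have e : (a : ℝ) = G.degree u + G.degree w - b - 3 := by linarith
        rw [e] at h2R ⊢
        linarith)
    rw [hs, hVR]
    have habR : (2 : ℝ) ≤ a + b := by exact_mod_cast hab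
    have hlt : ((G.degree u : ℝ) - 1) * (G.degree w - 1) < ((a : ℝ) + 1) * (b + 1) - 1 := by
      have e : (G.degree w : ℝ) = a + b + 3 - G.degree u := by linarith
      rw [e]
      rcases hba with rfl | rfl
      · nlinarith [sq_nonneg ((G.degree u : ℝ) - b - 3 / 2)]
      · push_cast at *
        nlinarith [sq_nonneg ((G.degree u : ℝ) - a - 2)]
    linarith [Real.sqrt_lt_sqrt hM hlt]
  · have hpos : G.degree u + G.degree w = a + b + 2 := by omega
    by_cases hbal : G.degree u = a + 1 ∨ G.degree u = b + 1
    · right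
      rcases hbal with h | h
      · exact hG.nonempty_iso_doubleComet huw hadj hcov huc hwc h (by omega) hV
      · exact hG.nonempty_iso_doubleComet huw.symm (fun h => hadj h.symm)
          (fun x y h => by have := hcov x y h; tauto) hwc huc (by omega) h hV
    · left
      have h1R : (G.degree u : ℝ) + G.degree w = a + b + 2 := by exact_mod_cast hpos
      have h2R : ∑ v, (G.degree v : ℝ) ^ 2 =
          (G.degree u : ℝ) ^ 2 + G.degree w ^ 2 + (a + b + 3) + 1 := by
        rw [hV] at h2
        exact_mod_cast h2
      obtain ⟨hM, hs⟩ := hG.spectralSum_sq_of_cover (by omega) hcov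
        (M := (G.degree u : ℝ) * G.degree w - 1) (by
          rw [hVR, h2R]
          have e : (a : ℝ) = G.degree u + G.degree w - b - 2 := by linarith
          rw [e]
          ring)
      rw [hs, hVR]
      have hlt : (G.degree u : ℝ) * G.degree w - 1 < ((a : ℝ) + 1) * (b + 1) - 1 := by
        have e : (G.degree w : ℝ) = a + b + 2 - G.degree u := by linarith
        have hp : 0 < ((G.degree u : ℝ) - (a + 1)) * (G.degree u - (b + 1)) := by
          rcases (show G.degree u < a + 1 ∨ b + 1 < G.degree u by omega) with h | h
          · have h' : (G.degree u : ℝ) < a + 1 := by exact_mod_cast h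
            have h'' : (G.degree u : ℝ) < b + 1 := by
              exact_mod_cast (show G.degree u < b + 1 by omega)
            exact mul_pos_of_neg_of_neg (by linarith) (by linarith)
          · have h' : (b : ℝ) + 1 < G.degree u := by exact_mod_cast h
            have h'' : (a : ℝ) + 1 < G.degree u := by
              exact_mod_cast (show a + 1 < G.degree u by omega)
            exact mul_pos (by linarith) (by linarith)
        rw [e]
        nlinarith
      linarith [Real.sqrt_lt_sqrt hM hlt]

/-- The balanced double comet on a path with three vertices is the unique tree of its order with the
largest spectral sum. -/
theorem SimpleGraph.IsTree.spectralSum_lt_or_iso {V : Type*} [Fintype V] {G : SimpleGraph V}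
    (hG : G.IsTree) {a b : ℕ} (hab : 2 ≤ a + b) (hba : b = a ∨ b = a + 1)
    (hV : Fintype.card V = a + b + 3) :
    spectralSum G < spectralSum (doubleComet a b 3) ∨ Nonempty (G ≃g doubleComet a b 3) := by
  have hH := (doubleComet_three_isTree a b).spectralSum_nonneg (by simp; omega)
  have := hG.connected.nonempty
  have : Nontrivial V := Fintype.one_lt_card_iff_nontrivial.1 (by omega)
  have key : spectralSum G ^ 2 < ((a : ℝ) + b + 2) + 2 * √(((a : ℝ) + 1) * (b + 1) - 1) ∨
      Nonempty (G ≃g doubleComet a b 3) := by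
    rcases hG.isAcyclic.exists_cover_or_matching with ⟨u, w, hcov⟩ | ⟨f, hf, h01, h23, h45, h0, h2⟩
    · by_cases huw : u = w
      · -- A star is covered by its centre together with any other vertex.
        obtain ⟨w', hw'⟩ := exists_ne u
        refine hG.spectralSum_sq_lt_or_iso_of_cover hab hba hV hw'.symm fun x y h => ?_
        have := hcov x y h
        rw [← huw] at this
        tauto
      · exact hG.spectralSum_sq_lt_or_iso_of_cover hab hba hV huw hcov
    · left
      have hcard : 6 ≤ Fintype.card V := by simpa using Fintype.card_le_of_injective f hf
      have h3 := three_div_seven_le_adjEigenvalue hG.isAcyclic hf h01 h23 h45 h0 h2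
      have hM : ((((a + 1) * (b + 1) - 1 : ℕ)) : ℝ) = ((a : ℝ) + 1) * (b + 1) - 1 := by
        rw [Nat.cast_sub (Nat.mul_pos a.succ_pos b.succ_pos)]
        push_cast
        rfl
      have hM1 : 1 ≤ (a + 1) * (b + 1) := Nat.mul_pos a.succ_pos b.succ_pos
      have := spectralSum_sq_lt_of_matching hG h3 (N := a + b + 2) (M := (a + 1) * (b + 1) - 1)
        (by omega) (by omega) ?_ ?_
      · rw [hM] at this
        exact_mod_cast this
      · zify [hM1]
        rcases hba with rfl | rfl
        · nlinarith
        · push_cast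
          nlinarith
      · intro h
        obtain ⟨rfl, rfl⟩ : a = 2 ∧ b = 2 := by omega
        rfl
  rw [← doubleComet_three_spectralSum_sq a b (by omega)] at key
  exact key.imp_left fun h => lt_of_pow_lt_pow_left₀ 2 hH h

end Extremal

theorem theorem1p5 (n : ℕ) (hn : 5 ≤ n) :
    (doubleComet ((n - 3) / 2) ((n - 3) ⌈/⌉ 2) 3).IsTree ∧
    Fintype.card (Fin ((n - 3) / 2) ⊕ Fin 3 ⊕ Fin ((n - 3) ⌈/⌉ 2)) = n ∧
    ∀ (V : Type*) [Fintype V] (T : SimpleGraph V), T.IsTree → Fintype.card V = n →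
      spectralSum T ≤ spectralSum (doubleComet ((n - 3) / 2) ((n - 3) ⌈/⌉ 2) 3) ∧
      (spectralSum T = spectralSum (doubleComet ((n - 3) / 2) ((n - 3) ⌈/⌉ 2) 3) ↔
        Nonempty (T ≃g doubleComet ((n - 3) / 2) ((n - 3) ⌈/⌉ 2) 3)) := by
  have hceil : (n - 3) ⌈/⌉ 2 = (n - 3 + 1) / 2 := Nat.ceilDiv_eq_add_pred_div _ _
  obtain ⟨a, ha⟩ : ∃ a, (n - 3) / 2 = a := ⟨_, rfl⟩
  obtain ⟨b, hb⟩ : ∃ b, (n - 3) ⌈/⌉ 2 = b := ⟨_, rfl⟩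
  rw [ha, hb]
  rw [hceil] at hb
  refine ⟨doubleComet_three_isTree a b, ?_, fun V _ T hT hV => ?_⟩
  · simp only [Fintype.card_sum, Fintype.card_fin]
    omega
  have hiso : Nonempty (T ≃g doubleComet a b 3) →
      spectralSum T = spectralSum (doubleComet a b 3) := fun ⟨e⟩ => by
    rw [spectralSum, spectralSum, adjEigenvalue_congr e, adjEigenvalue_congr e]
  rcases hT.spectralSum_lt_or_iso (a := a) (b := b) (by omega) (by omega) (by omega) with h | h
  · exact ⟨h.le, fun h' => absurd h' h.ne, hiso⟩
  · exact ⟨(hiso h).le, fun _ => h, hiso⟩
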